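/- Let $\varphi:\mathbb R\to\mathbb R$ be a smooth ($C^\infty$) function supported on $[-1,1]$ with $\int_0^1|\varphi'(x)|^2\,dx=1$. For real $R>1$ and $n\in\mathbb Z$ define the truncated von Mangoldt function $$\Lambda_{R,\varphi}(n):=\log R\sum_{d\mid n}\mu(d)\,\varphi\!\left(\frac{\log d}{\log R}\right),$$ where $d$ ranges over the positive divisors of $n$ and $\mu$ is the Möbius function, and define the Goldston–Yıldırım enveloping sieve $$\nu_{R,\varphi}(n):=\frac{1}{\log R}\,\Lambda_{R,\varphi}(n)^2 .$$ Let $\varepsilon>0$. If $N$ is a positive integer and $R$ is a real number with $N^{\varepsilon}\le R\le N^{1/2-\varepsilon}$, then $$\frac1N\sum_{1\le n\le N}\nu_{R,\varphi}(n)=1+o_{N\to\infty;\varepsilon,\varphi}(1),$$ where the error term tends to $0$ as $N\to\infty$ for fixed $\varepsilon,\varphi$, uniformly in $R$. That is, for every $\delta>0$ there is $N_0=N_0(\delta,\varepsilon,\varphi)$ such that for all integers $N\ge N_0$ and all real $R$ with $N^{\varepsilon}\le R\le N^{1/2-\varepsilon}$, $$\left|\frac1N\sum_{n=1}^N\nu_{R,\varphi}(n)-1\right|\le\delta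 .$$ -/

import Mathlib

open scoped ContDiff

/-- The truncated von Mangoldt function
`Λ_{R,φ}(n) = log R * ∑_{d ∣ n} μ(d) φ(log d / log R)`, where `d` ranges over the positive
divisors of the integer `n`. When `n ≠ 0` there are finitely many divisors; when `n = 0` all
`d ≥ 1` are admitted, and for `R > 1` and `φ` supported in `[-1,1]` only finitely many terms
(those with `d ≤ R`) are non-zero. -/
noncomputable def truncatedVonMangoldt (R : ℝ) (φ : ℝ → ℝ) (n : ℤ) : ℝ :=
  Real.log R *
    ∑ᶠ (d : ℕ) (_ : 0 < d ∧ (d : ℤ) ∣ n),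
      (ArithmeticFunction.moebius d : ℝ) * φ (Real.log d / Real.log R)

/-- The enveloping sieve `ν_{R,φ} = Λ_{R,φ}² / log R`. -/
noncomputable def envelopingSieve (R : ℝ) (φ : ℝ → ℝ) (n : ℤ) : ℝ :=
  1 / Real.log R * truncatedVonMangoldt R φ n ^ 2

/-! Put `c d = μ(d) φ(log d / log R)`. Opening the square and summing over `n` turns the average
into `log R * ∑_{d,e ≤ R} c d * c e / [d,e]`, with an error `O(R² log R / N)` that dies because `R²
≤ N^(1-2ε)`. What remains depends on `R` alone, and `R ≥ N^ε` tends to infinity uniformly, so it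
suffices to find its limit (`tendsto_lcm_quadratic_form`).

Fourier inversion of `φ(x) e^x` gives `φ(x) = ∫ ψ(ξ) e^{-zx} dξ` with `z = 1 - 2πiξ` and `ψ` rapidly
decreasing. With `σ = 1 / log R` the quadratic form is then the integral of `ψ ⊗ ψ` against `∑ μ(d)
μ(e) d^{-σz} e^{-σw} / [d,e]`. By its Euler product, this series is `ζ(1+σz+σw) / (ζ(1+σz) ζ(1+σw))`
times a factor tending to `1`, so divided by `σ` it tends to `zw/(z+w)` (`tendsto_lcmSeries_div`).
The bound `O(σ |z|² |w|²)` of `exists_norm_lcmSeries_le`, valid for all frequencies, permits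
dominated convergence. Finally `1/(z+w) = ∫_0^∞ e^{-(z+w)x} dx` folds the limit into `∫_0^∞ φ'(x)²
dx = 1`. -/

/-! ### Opening the square -/

theorem truncatedVonMangoldt_eq_sum {R : ℝ} (hR : 1 < R) {φ : ℝ → ℝ}
    (hsupp : Function.support φ ⊆ Set.Icc (-1) 1) (n : ℕ) :
    truncatedVonMangoldt R φ (n : ℤ) = Real.log R *
      ∑ d ∈ (Finset.Icc 1 ⌊R⌋₊).filter (· ∣ n),
        (ArithmeticFunction.moebius d : ℝ) * φ (Real.log d / Real.log R) := by
  unfold truncatedVonMangoldt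
  congr 1
  refine finsum_mem_eq_sum_of_inter_support_eq _ ?_
  ext d
  simp only [Set.mem_inter_iff, Set.mem_ofPred_eq, Function.mem_support, Finset.coe_filter,
    Finset.mem_Icc, Int.natCast_dvd_natCast]
  constructor
  · rintro ⟨⟨h0, hd⟩, hne⟩
    refine ⟨⟨⟨h0, ?_⟩, hd⟩, hne⟩
    have h1 : φ (Real.log d / Real.log R) ≠ 0 := right_ne_zero_of_mul hne
    have h2 := (hsupp h1).2
    rw [div_le_one (Real.log_pos hR)] at h2
    have hd0 : (0 : ℝ) < d := by exact_mod_cast h0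
    exact Nat.le_floor ((Real.log_le_log_iff hd0 (by linarith)).1 h2)
  · rintro ⟨⟨⟨h0, -⟩, hd⟩, hne⟩
    exact ⟨⟨h0, hd⟩, hne⟩

theorem abs_div_sub_le_one (N m : ℕ) : |((N / m : ℕ) : ℝ) - (N : ℝ) / m| ≤ 1 := by
  rcases Nat.eq_zero_or_pos m with rfl | hm
  · simp
  have hm' : (0 : ℝ) < m := by exact_mod_cast hm
  have h1 : ((N / m : ℕ) : ℝ) ≤ (N : ℝ) / m := Nat.cast_div_le
  have h2 : (N : ℝ) / m < (N / m : ℕ) + 1 := by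
    rw [div_lt_iff₀ hm']
    have h3 := Nat.div_add_mod N m
    have h4 := Nat.mod_lt N hm
    exact_mod_cast (by linarith : N < (N / m + 1) * m)
  rw [abs_le]; constructor <;> linarith

theorem sum_sq_sum_dvd (c : ℕ → ℝ) (D : Finset ℕ) (N : ℕ) :
    ∑ n ∈ Finset.Icc 1 N, (∑ d ∈ D.filter (· ∣ n), c d) ^ 2 =
      ∑ d ∈ D, ∑ e ∈ D, c d * c e * ((N / Nat.lcm d e : ℕ) : ℝ) := by
  have h1 : ∀ n, (∑ d ∈ D.filter (· ∣ n), c d) ^ 2 =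
      ∑ d ∈ D, ∑ e ∈ D, c d * c e * (if Nat.lcm d e ∣ n then 1 else 0) := by
    intro n
    rw [sq, Finset.sum_filter, Finset.sum_mul_sum]
    refine Finset.sum_congr rfl fun d _ => Finset.sum_congr rfl fun e _ => ?_
    simp only [Nat.lcm_dvd_iff]
    by_cases hd : d ∣ n <;> by_cases he : e ∣ n <;> simp [hd, he]
  simp_rw [h1]
  rw [Finset.sum_comm]
  refine Finset.sum_congr rfl fun d _ => ?_
  rw [Finset.sum_comm]
  refine Finset.sum_congr rfl fun e _ => ?_
  rw [← Finset.mul_sum, Finset.sum_boole, ← Nat.Ioc_filter_dvd_card_eq_div]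
  rfl

/-- Removing the floor from `N / [d,e]` costs at most `1` for each of the `|D|²` pairs; no
cancellation is needed. -/
theorem abs_sum_sq_sum_dvd_sub_le (c : ℕ → ℝ) (D : Finset ℕ) {C : ℝ} (hc : ∀ d, |c d| ≤ C)
    {N : ℕ} (hN : 0 < N) :
    |(∑ n ∈ Finset.Icc 1 N, (∑ d ∈ D.filter (· ∣ n), c d) ^ 2) / (N : ℝ) -
      ∑ d ∈ D, ∑ e ∈ D, c d * c e / (Nat.lcm d e : ℝ)| ≤ (C * D.card) ^ 2 / N := by
  have hN' : (0 : ℝ) < N := by exact_mod_cast hN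
  have hC : 0 ≤ C := (abs_nonneg _).trans (hc 0)
  have h : (∑ n ∈ Finset.Icc 1 N, (∑ d ∈ D.filter (· ∣ n), c d) ^ 2) / (N : ℝ) -
      ∑ d ∈ D, ∑ e ∈ D, c d * c e / (Nat.lcm d e : ℝ) =
      (∑ d ∈ D, ∑ e ∈ D, c d * c e *
        (((N / Nat.lcm d e : ℕ) : ℝ) - (N : ℝ) / (Nat.lcm d e : ℝ))) / N := by
    rw [sum_sq_sum_dvd, eq_div_iff hN'.ne', sub_mul, div_mul_cancel₀ _ hN'.ne', Finset.sum_mul,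
      ← Finset.sum_sub_distrib]
    refine Finset.sum_congr rfl fun d _ => ?_
    rw [Finset.sum_mul, ← Finset.sum_sub_distrib]
    refine Finset.sum_congr rfl fun e _ => ?_
    ring
  rw [h, abs_div, abs_of_pos hN']
  gcongr
  calc _ ≤ ∑ d ∈ D, ∑ e ∈ D, C * C := by
        refine (Finset.abs_sum_le_sum_abs _ _).trans (Finset.sum_le_sum fun d _ => ?_)
        refine (Finset.abs_sum_le_sum_abs _ _).trans (Finset.sum_le_sum fun e _ => ?_)
        rw [abs_mul, abs_mul]
        calc _ ≤ C * C * 1 := by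
              gcongr
              exacts [hc d, hc e, abs_div_sub_le_one _ _]
          _ = C * C := mul_one _
    _ = _ := by simp; ring

/-! ### Convolution over least common multiples -/

open ArithmeticFunction in
/-- The convolution `∑_{[d, e] = n} a(d) b(e)`, expressed through Möbius inversion. -/
noncomputable def lcmConvolution (a b : ArithmeticFunction ℂ) : ArithmeticFunction ℂ :=
  ((ArithmeticFunction.pmul (a * (zeta : ArithmeticFunction ℂ))
    (b * (zeta : ArithmeticFunction ℂ)))) * (moebius : ArithmeticFunction ℂ)

namespace lcmConvolution

open ArithmeticFunction

variable {a b : ArithmeticFunction ℂ}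

theorem mul_zeta (a b : ArithmeticFunction ℂ) :
    lcmConvolution a b * (zeta : ArithmeticFunction ℂ) =
      ArithmeticFunction.pmul (a * (zeta : ArithmeticFunction ℂ))
        (b * (zeta : ArithmeticFunction ℂ)) := by
  rw [lcmConvolution, mul_assoc, coe_moebius_mul_coe_zeta, mul_one]

theorem isMultiplicative (ha : a.IsMultiplicative) (hb : b.IsMultiplicative) :
    (lcmConvolution a b).IsMultiplicative :=
  ((ha.mul isMultiplicative_zeta.natCast).pmul (hb.mul isMultiplicative_zeta.natCast)).mul
    isMultiplicative_moebius.intCast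

theorem sum_divisors (a b : ArithmeticFunction ℂ) (n : ℕ) :
    ∑ m ∈ n.divisors, lcmConvolution a b m =
      (∑ d ∈ n.divisors, a d) * ∑ e ∈ n.divisors, b e := by
  have h := congrArg (fun f : ArithmeticFunction ℂ => f n) (mul_zeta a b)
  simpa only [pmul_apply, coe_mul_zeta_apply] using h

/-- Both sides have the same divisor sums, since pairs of divisors of `n` can be grouped by their
lcm; strong induction cancels the proper divisors. -/
theorem apply_eq_sum (a b : ArithmeticFunction ℂ) (n : ℕ) :
    lcmConvolution a b n =
      ∑ p ∈ (n.divisors ×ˢ n.divisors).filter (fun p => Nat.lcm p.1 p.2 = n), a p.1 * b p.2 := by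
  induction n using Nat.strong_induction_on with
  | _ n ih =>
    rcases Nat.eq_zero_or_pos n with rfl | hn
    · simp
    have h1 := sum_divisors a b n
    rw [Finset.sum_mul_sum, ← Finset.sum_product'] at h1
    have h2 : ∑ p ∈ n.divisors ×ˢ n.divisors, a p.1 * b p.2 =
        ∑ m ∈ n.divisors, ∑ p ∈ (m.divisors ×ˢ m.divisors).filter
          (fun p => Nat.lcm p.1 p.2 = m), a p.1 * b p.2 := by
      rw [← Finset.sum_fiberwise_of_maps_to (s := n.divisors ×ˢ n.divisors) (t := n.divisors)
        (g := fun p => Nat.lcm p.1 p.2)]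
      · refine Finset.sum_congr rfl fun m hm => Finset.sum_congr ?_ fun _ _ => rfl
        ext ⟨d, e⟩
        simp only [Finset.mem_filter, Finset.mem_product, Nat.mem_divisors] at hm ⊢
        constructor
        · rintro ⟨⟨⟨h3, -⟩, ⟨h4, -⟩⟩, rfl⟩
          have h5 := ne_zero_of_dvd_ne_zero hm.2 hm.1
          exact ⟨⟨⟨Nat.dvd_lcm_left _ _, h5⟩, ⟨Nat.dvd_lcm_right _ _, h5⟩⟩, rfl⟩
        · rintro ⟨⟨⟨h3, -⟩, ⟨h4, -⟩⟩, rfl⟩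
          exact ⟨⟨⟨h3.trans hm.1, hm.2⟩, ⟨h4.trans hm.1, hm.2⟩⟩, rfl⟩
      · rintro ⟨d, e⟩ h
        simp only [Finset.mem_product, Nat.mem_divisors] at h ⊢
        exact ⟨Nat.lcm_dvd h.1.1 h.2.1, hn.ne'⟩
    rw [h2, ← Nat.cons_self_properDivisors hn.ne', Finset.sum_cons, Finset.sum_cons,
      Finset.sum_congr rfl fun m hm => ih m (Nat.mem_properDivisors.1 hm).2] at h1
    exact add_right_cancel h1

end lcmConvolution

/-! ### The double Dirichlet series and its Euler product -/

theorem summable_lcm_rpow {σ : ℝ} (hσ : 0 < σ) :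
    Summable fun p : ℕ × ℕ => (Nat.lcm p.1 p.2 : ℝ) ^ (-(1 + σ)) := by
  have h1 : Summable fun n : ℕ => (n : ℝ) ^ (-(1 + σ)) :=
    Real.summable_nat_rpow.2 (by linarith)
  have h0 : ∀ n : ℕ, 0 ≤ (n : ℝ) ^ (-(1 + σ)) := fun n => by positivity
  have h2 := h1.mul_of_nonneg (h1.mul_of_nonneg h1 h0 h0) h0 (fun p => mul_nonneg (h0 _) (h0 _))
  -- With `d = ga`, `e = gb`, `g = gcd(d,e)`, one has `[d,e] = gab`. Forgetting that `a` and `b` are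
  -- coprime leaves a product of three convergent series.
  let ι : ℕ × ℕ → ℕ × ℕ × ℕ := fun p =>
    (Nat.gcd p.1 p.2, p.1 / Nat.gcd p.1 p.2, p.2 / Nat.gcd p.1 p.2)
  have hι : Function.Injective ι := by
    rintro ⟨d, e⟩ ⟨d', e'⟩ h
    simp only [ι, Prod.mk.injEq] at h
    obtain ⟨hg, h3, h4⟩ := h
    have e1 := Nat.mul_div_cancel' (Nat.gcd_dvd_left d e)
    have e2 := Nat.mul_div_cancel' (Nat.gcd_dvd_right d e)
    have e3 := Nat.mul_div_cancel' (Nat.gcd_dvd_left d' e')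
    have e4 := Nat.mul_div_cancel' (Nat.gcd_dvd_right d' e')
    rw [h3, hg, e3] at e1
    rw [h4, hg, e4] at e2
    rw [e1, e2]
  refine (h2.comp_injective hι).congr fun p => ?_
  obtain ⟨d, e⟩ := p
  have e1 : Nat.lcm d e = Nat.gcd d e * (d / Nat.gcd d e * (e / Nat.gcd d e)) := by
    rw [Nat.lcm, ← mul_assoc, Nat.mul_div_cancel' (Nat.gcd_dvd_left d e),
      Nat.mul_div_assoc _ (Nat.gcd_dvd_right d e)]
  simp only [Function.comp_apply, ι]
  rw [e1, Nat.cast_mul, Nat.cast_mul, Real.mul_rpow (by positivity) (by positivity),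
    Real.mul_rpow (by positivity) (by positivity)]

/-- The arithmetic function `n ↦ μ(n) n^{-s}`. -/
noncomputable def moebiusTwist (s : ℂ) : ArithmeticFunction ℂ :=
  ⟨fun n => (ArithmeticFunction.moebius n : ℂ) * (n : ℂ) ^ (-s), by simp⟩

theorem moebiusTwist_apply (s : ℂ) (n : ℕ) :
    moebiusTwist s n = (ArithmeticFunction.moebius n : ℂ) * (n : ℂ) ^ (-s) := rfl

theorem moebiusTwist_isMultiplicative (s : ℂ) : (moebiusTwist s).IsMultiplicative := by
  refine ⟨by simp [moebiusTwist_apply], fun {m n} h => ?_⟩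
  rw [moebiusTwist_apply, moebiusTwist_apply, moebiusTwist_apply,
    ArithmeticFunction.isMultiplicative_moebius.map_mul_of_coprime h, Int.cast_mul, Nat.cast_mul,
    Complex.natCast_mul_natCast_cpow]
  ring

theorem sum_divisors_prime_pow_moebiusTwist (s : ℂ) {p : ℕ} (hp : p.Prime) (k : ℕ) :
    ∑ d ∈ (p ^ (k + 1)).divisors, moebiusTwist s d = 1 - (p : ℂ) ^ (-s) := by
  rw [Nat.sum_divisors_prime_pow hp, Finset.sum_range_succ', Finset.sum_range_succ']
  rw [Finset.sum_eq_zero]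
  · simp [moebiusTwist_apply, ArithmeticFunction.moebius_apply_prime hp]; ring
  · intro i _
    rw [moebiusTwist_apply, ArithmeticFunction.moebius_apply_prime_pow hp (by omega),
      if_neg (by omega)]
    simp

/-- The value is the difference of the divisor sums at `p^(k+2)` and `p^(k+1)`, which agree because
`μ` kills higher prime powers. -/
theorem lcmConvolution_moebiusTwist_prime_pow (s t : ℂ) {p : ℕ} (hp : p.Prime) (k : ℕ) :
    lcmConvolution (moebiusTwist s) (moebiusTwist t) (p ^ (k + 2)) = 0 := by
  have h1 := lcmConvolution.sum_divisors (moebiusTwist s) (moebiusTwist t) (p ^ (k + 1 + 1))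
  have h2 := lcmConvolution.sum_divisors (moebiusTwist s) (moebiusTwist t) (p ^ (k + 1))
  rw [sum_divisors_prime_pow_moebiusTwist s hp, sum_divisors_prime_pow_moebiusTwist t hp] at h1 h2
  rw [Nat.sum_divisors_prime_pow hp] at h1 h2
  rw [Finset.sum_range_succ, h2] at h1
  simpa using h1

theorem lcmConvolution_moebiusTwist_prime (s t : ℂ) {p : ℕ} (hp : p.Prime) :
    lcmConvolution (moebiusTwist s) (moebiusTwist t) p =
      (1 - (p : ℂ) ^ (-s)) * (1 - (p : ℂ) ^ (-t)) - 1 := by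
  have h1 := lcmConvolution.sum_divisors (moebiusTwist s) (moebiusTwist t) (p ^ (0 + 1))
  rw [sum_divisors_prime_pow_moebiusTwist s hp, sum_divisors_prime_pow_moebiusTwist t hp] at h1
  have h2 := (lcmConvolution.isMultiplicative (moebiusTwist_isMultiplicative s)
    (moebiusTwist_isMultiplicative t)).map_one
  rw [Nat.sum_divisors_prime_pow hp, Finset.sum_range_succ, Finset.sum_range_one, pow_zero, h2,
    pow_one] at h1
  rw [← h1]; ring

/-- The summand `μ(d) μ(e) d^{-s} e^{-t} / [d, e]`. -/
noncomputable def lcmTerm (s t : ℂ) (p : ℕ × ℕ) : ℂ :=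
  moebiusTwist s p.1 * moebiusTwist t p.2 / (Nat.lcm p.1 p.2 : ℂ)

theorem norm_moebiusTwist_le {s : ℂ} {σ : ℝ} (hs : σ ≤ s.re) {n : ℕ} (hn : 0 < n) :
    ‖moebiusTwist s n‖ ≤ (n : ℝ) ^ (-σ) := by
  have h1 : ‖((ArithmeticFunction.moebius n : ℤ) : ℂ)‖ ≤ 1 := by
    rw [Complex.norm_intCast]
    exact_mod_cast ArithmeticFunction.abs_moebius_le_one
  rw [moebiusTwist_apply, norm_mul, Complex.norm_natCast_cpow_of_pos hn]
  calc _ ≤ 1 * (n : ℝ) ^ (-σ) := by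
        gcongr
        · exact_mod_cast hn
        · simpa using hs
    _ = _ := one_mul _

theorem norm_lcmTerm_le {s t : ℂ} {σ : ℝ} (hσ : 0 < σ) (hs : σ ≤ s.re) (ht : σ ≤ t.re)
    (p : ℕ × ℕ) : ‖lcmTerm s t p‖ ≤ (Nat.lcm p.1 p.2 : ℝ) ^ (-(1 + σ)) := by
  obtain ⟨d, e⟩ := p
  have h0 : 0 ≤ (Nat.lcm d e : ℝ) ^ (-(1 + σ)) := by positivity
  rcases Nat.eq_zero_or_pos d with rfl | hd
  · simpa [lcmTerm] using h0
  rcases Nat.eq_zero_or_pos e with rfl | he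
  · simpa [lcmTerm] using h0
  have hl : 0 < Nat.lcm d e := Nat.lcm_pos hd he
  have hl' : (0 : ℝ) < (Nat.lcm d e : ℝ) := by exact_mod_cast hl
  have h1 : (Nat.lcm d e : ℝ) ≤ (d : ℝ) * e := by
    exact_mod_cast Nat.le_of_dvd (Nat.mul_pos hd he) (Nat.lcm_dvd_mul d e)
  simp only [lcmTerm]
  rw [norm_div, norm_mul, Complex.norm_natCast, div_le_iff₀ hl', neg_add, add_comm,
    Real.rpow_add hl', Real.rpow_neg_one, mul_assoc, inv_mul_cancel₀ hl'.ne', mul_one]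
  calc _ ≤ (d : ℝ) ^ (-σ) * (e : ℝ) ^ (-σ) := by
        gcongr
        exacts [norm_moebiusTwist_le hs hd, norm_moebiusTwist_le ht he]
    _ = ((d : ℝ) * e) ^ (-σ) := by rw [Real.mul_rpow (by positivity) (by positivity)]
    _ ≤ _ := Real.rpow_le_rpow_of_nonpos hl' h1 (by linarith)

theorem summable_norm_lcmTerm {s t : ℂ} (hs : 0 < s.re) (ht : 0 < t.re) :
    Summable fun p => ‖lcmTerm s t p‖ := by
  have h : 0 < min s.re t.re := lt_min hs ht
  exact (summable_lcm_rpow h).of_nonneg_of_le (fun _ => norm_nonneg _)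
    (norm_lcmTerm_le h (min_le_left _ _) (min_le_right _ _))

/-- The double Dirichlet series `∑_{d,e} μ(d) μ(e) d^{-s} e^{-t} / [d, e]`. -/
noncomputable def lcmSeries (s t : ℂ) : ℂ := ∑' p, lcmTerm s t p

theorem hasSum_lcmConvolution_div {s t : ℂ} (hs : 0 < s.re) (ht : 0 < t.re) :
    HasSum (fun n : ℕ => lcmConvolution (moebiusTwist s) (moebiusTwist t) n / (n : ℂ))
      (lcmSeries s t) := by
  have h1 : HasSum (lcmTerm s t) (lcmSeries s t) := (summable_norm_lcmTerm hs ht).of_norm.hasSum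
  have key : ∀ n : ℕ, ∑' b : (fun p : ℕ × ℕ => Nat.lcm p.1 p.2) ⁻¹' {n}, lcmTerm s t b =
      lcmConvolution (moebiusTwist s) (moebiusTwist t) n / (n : ℂ) := fun n => ?_
  · have h2 := h1.tsum_fiberwise fun p => Nat.lcm p.1 p.2
    simp only [key] at h2
    exact h2
  rw [tsum_subtype, tsum_eq_sum
    (s := (n.divisors ×ˢ n.divisors).filter (fun p => Nat.lcm p.1 p.2 = n)),
    lcmConvolution.apply_eq_sum, Finset.sum_div]
  · refine Finset.sum_congr rfl fun p hp => ?_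
    have hp' := (Finset.mem_filter.1 hp).2
    rw [Set.indicator_of_mem (by simpa using hp'), lcmTerm, hp']
  · rintro ⟨d, e⟩ h
    by_cases hl : Nat.lcm d e = n
    · rw [Set.indicator_of_mem (by simpa using hl)]
      -- The fibre over `0` is infinite, but its terms vanish since they are divided by `0`.
      rcases Nat.eq_zero_or_pos n with rfl | hn
      · simp [lcmTerm, hl]
      · refine absurd ?_ h
        simp only [Finset.mem_filter, Finset.mem_product, Nat.mem_divisors]
        exact ⟨⟨⟨hl ▸ Nat.dvd_lcm_left _ _, hn.ne'⟩, ⟨hl ▸ Nat.dvd_lcm_right _ _, hn.ne'⟩⟩, hl⟩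
    · exact Set.indicator_of_notMem (by simpa using hl) _

theorem lcmSeries_hasProd {s t : ℂ} (hs : 0 < s.re) (ht : 0 < t.re) :
    HasProd (fun p : Nat.Primes => 1 - (p : ℂ) ^ (-(1 + s)) - (p : ℂ) ^ (-(1 + t)) +
      (p : ℂ) ^ (-(1 + s + t))) (lcmSeries s t) := by
  have h0 := hasSum_lcmConvolution_div hs ht
  have hm := lcmConvolution.isMultiplicative (moebiusTwist_isMultiplicative s)
    (moebiusTwist_isMultiplicative t)
  have h1 := EulerProduct.eulerProduct_hasProd
    (f := fun n : ℕ => lcmConvolution (moebiusTwist s) (moebiusTwist t) n / (n : ℂ))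
    (by simp [hm.map_one])
    (fun {m n} h => by simp only [hm.map_mul_of_coprime h]; push_cast; ring)
    h0.summable.norm (by simp)
  rw [h0.tsum_eq] at h1
  convert h1 using 2 with p
  have hp := p.prop
  have hp0 : (p : ℂ) ≠ 0 := by exact_mod_cast hp.ne_zero
  rw [tsum_eq_sum (s := Finset.range 2), Finset.sum_range_succ, Finset.sum_range_one]
  · rw [pow_zero, pow_one, hm.map_one, lcmConvolution_moebiusTwist_prime s t hp, neg_add, neg_add,
      neg_add, neg_add, Complex.cpow_add _ _ hp0, Complex.cpow_add _ _ hp0,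
      Complex.cpow_add _ _ hp0, Complex.cpow_add _ _ hp0, Complex.cpow_neg_one]
    push_cast
    field_simp
    ring
  · intro k hk
    obtain ⟨j, rfl⟩ : ∃ j, k = j + 2 := ⟨k - 2, by simp at hk; omega⟩
    rw [lcmConvolution_moebiusTwist_prime_pow s t hp, zero_div]

/-! ### Comparison with zeta values -/

/-- The deviation from `1` of the local factor at `p` of
`∑ μ(d) μ(e) d^{-s} e^{-t} / [d, e] * (ζ(1 + s) ζ(1 + t) / ζ(1 + s + t))`. -/
noncomputable def lcmLocalFactor (s t : ℂ) (p : Nat.Primes) : ℂ :=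
  (((p : ℂ) ^ (-(1 + s)) + (p : ℂ) ^ (-(1 + t)) - (p : ℂ) ^ (-(1 + s + t))) *
    (p : ℂ) ^ (-(1 + s + t)) - (p : ℂ) ^ (-(1 + s)) * (p : ℂ) ^ (-(1 + t))) /
    ((1 - (p : ℂ) ^ (-(1 + s))) * (1 - (p : ℂ) ^ (-(1 + t))))

theorem norm_prime_cpow_le {s : ℂ} (hs : 1 ≤ s.re) (p : Nat.Primes) :
    ‖(p : ℂ) ^ (-s)‖ ≤ (p : ℝ)⁻¹ := by
  rw [Complex.norm_natCast_cpow_of_pos p.prop.pos, ← Real.rpow_neg_one]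
  exact Real.rpow_le_rpow_of_exponent_le (by exact_mod_cast p.prop.one_le) (by simpa using hs)

theorem half_le_norm_one_sub_prime_cpow {s : ℂ} (hs : 1 ≤ s.re) (p : Nat.Primes) :
    1 / 2 ≤ ‖1 - (p : ℂ) ^ (-s)‖ := by
  have h1 := norm_prime_cpow_le hs p
  have h2 : ((p : ℕ) : ℝ)⁻¹ ≤ 2⁻¹ := by
    gcongr
    exact_mod_cast p.prop.two_le
  have h3 := norm_sub_norm_le (1 : ℂ) ((p : ℂ) ^ (-s))
  rw [norm_one] at h3
  linarith

/-- The terms of order `1/p` have cancelled: the numerator is at most `4/p²` and the denominator at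
least `1/4`. Allowing real part `0` makes the bound uniform up to the limit point. -/
theorem norm_lcmLocalFactor_le {s t : ℂ} (hs : 0 ≤ s.re) (ht : 0 ≤ t.re) (p : Nat.Primes) :
    ‖lcmLocalFactor s t p‖ ≤ 16 * ((p : ℕ) : ℝ) ^ (-2 : ℝ) := by
  have hs1 : 1 ≤ (1 + s).re := by simpa using hs
  have ht1 : 1 ≤ (1 + t).re := by simpa using ht
  have hst1 : 1 ≤ (1 + s + t).re := by simp; linarith
  have x1 := norm_prime_cpow_le hs1 p
  have y1 := norm_prime_cpow_le ht1 p
  have w1 := norm_prime_cpow_le hst1 p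
  have x2 := half_le_norm_one_sub_prime_cpow hs1 p
  have y2 := half_le_norm_one_sub_prime_cpow ht1 p
  have e : ((p : ℕ) : ℝ) ^ (-2 : ℝ) = ((p : ℕ) : ℝ)⁻¹ * ((p : ℕ) : ℝ)⁻¹ := by
    rw [Real.rpow_neg (by positivity), Real.rpow_two, sq, mul_inv]
  rw [lcmLocalFactor, norm_div, norm_mul (1 - _), e, div_le_iff₀ (by positivity)]
  set x := (p : ℂ) ^ (-(1 + s))
  set y := (p : ℂ) ^ (-(1 + t))
  set w := (p : ℂ) ^ (-(1 + s + t))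
  set q : ℝ := ((p : ℕ) : ℝ)⁻¹
  have hq : 0 ≤ q := by positivity
  have n1 : ‖(x + y - w) * w - x * y‖ ≤ (q + q + q) * q + q * q := by
    refine (norm_sub_le _ _).trans (add_le_add ?_ ?_)
    · rw [norm_mul]
      gcongr
      exact (norm_sub_le _ _).trans (add_le_add ((norm_add_le _ _).trans (add_le_add x1 y1)) w1)
    · rw [norm_mul]
      gcongr
  calc _ ≤ 16 * (q * q) * (1 / 2 * (1 / 2)) := by linarith
    _ ≤ _ := by gcongr

theorem summable_sixteen_mul_prime_rpow :
    Summable fun p : Nat.Primes => 16 * ((p : ℕ) : ℝ) ^ (-2 : ℝ) :=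
  (Nat.Primes.summable_rpow.2 (by norm_num)).mul_left 16

/-- The Euler product comparing the double Dirichlet series with a ratio of zeta values. -/
noncomputable def lcmCorrection (s t : ℂ) : ℂ := ∏' p : Nat.Primes, (1 + lcmLocalFactor s t p)

theorem hasProd_lcmCorrection {s t : ℂ} (hs : 0 ≤ s.re) (ht : 0 ≤ t.re) :
    HasProd (fun p => 1 + lcmLocalFactor s t p) (lcmCorrection s t) :=
  (multipliable_one_add_of_summable (summable_sixteen_mul_prime_rpow.of_nonneg_of_le
    (fun _ => norm_nonneg _) (norm_lcmLocalFactor_le hs ht))).hasProd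

theorem exists_norm_lcmCorrection_le :
    ∃ C, 0 < C ∧ ∀ s t : ℂ, 0 ≤ s.re → 0 ≤ t.re → ‖lcmCorrection s t‖ ≤ C := by
  refine ⟨Real.exp (∑' p : Nat.Primes, 16 * ((p : ℕ) : ℝ) ^ (-2 : ℝ)), Real.exp_pos _,
    fun s t hs ht => ?_⟩
  refine le_of_tendsto (hasProd_lcmCorrection hs ht).norm (Filter.Eventually.of_forall fun S => ?_)
  have h1 := Finset.norm_prod_one_add_sub_one_le S (lcmLocalFactor s t)
  have h2 := norm_le_norm_sub_add (∏ p ∈ S, (1 + lcmLocalFactor s t p)) 1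
  have h3 : ∑ p ∈ S, ‖lcmLocalFactor s t p‖ ≤
      ∑' p : Nat.Primes, 16 * ((p : ℕ) : ℝ) ^ (-2 : ℝ) :=
    (Finset.sum_le_sum fun p _ => norm_lcmLocalFactor_le hs ht p).trans
      (summable_sixteen_mul_prime_rpow.sum_le_tsum _ fun p _ => by positivity)
  have h4 := Real.exp_le_exp.2 h3
  rw [norm_one] at h2
  simp only [← norm_prod]
  linarith

/-- At `s = t = 0` every local deviation vanishes, as its numerator is `p⁻¹ p⁻¹ - p⁻¹ p⁻¹`; the
uniform bound carries the limit through the product. -/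
theorem tendsto_lcmCorrection {α : Type*} {l : Filter α} {s t : α → ℂ}
    (hs : Filter.Tendsto s l (nhds 0)) (ht : Filter.Tendsto t l (nhds 0))
    (hs0 : ∀ᶠ a in l, 0 ≤ (s a).re) (ht0 : ∀ᶠ a in l, 0 ≤ (t a).re) :
    Filter.Tendsto (fun a => lcmCorrection (s a) (t a)) l (nhds 1) := by
  have h1 : Filter.Tendsto (fun a => lcmCorrection (s a) (t a)) l
      (nhds (∏' _ : Nat.Primes, (1 + (0 : ℂ)))) := by
    refine tendsto_tprod_one_add_of_dominated_convergence summable_sixteen_mul_prime_rpow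
      (fun p => ?_) ((hs0.and ht0).mono fun a ha p => norm_lcmLocalFactor_le ha.1 ha.2 p)
    have hp0 : (p : ℂ) ≠ 0 := by exact_mod_cast p.prop.ne_zero
    have hp1 : 1 - (p : ℂ)⁻¹ ≠ 0 := by
      have h := half_le_norm_one_sub_prime_cpow (s := 1) (by simp) p
      rw [Complex.cpow_neg_one] at h
      intro h0
      rw [h0, norm_zero] at h
      norm_num at h
    have hc : ContinuousAt (fun z : ℂ × ℂ => lcmLocalFactor z.1 z.2 p) (0, 0) := by
      unfold lcmLocalFactor
      have hc1 : ∀ f : ℂ × ℂ → ℂ, Continuous f → ContinuousAt (fun z => (p : ℂ) ^ f z) (0, 0) :=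
        fun f hf => (hf.const_cpow (Or.inl hp0)).continuousAt
      refine ContinuousAt.div ?_ ?_ (by simpa [Complex.cpow_neg_one] using hp1)
      · exact (((hc1 _ (by fun_prop)).add (hc1 _ (by fun_prop))).sub (hc1 _ (by fun_prop))).mul
          (hc1 _ (by fun_prop)) |>.sub ((hc1 _ (by fun_prop)).mul (hc1 _ (by fun_prop)))
      · exact (continuousAt_const.sub (hc1 _ (by fun_prop))).mul
          (continuousAt_const.sub (hc1 _ (by fun_prop)))
    have h2 := hc.tendsto.comp (hs.prodMk_nhds ht)
    have h3 : lcmLocalFactor 0 0 p = 0 := by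
      simp [lcmLocalFactor]
    simpa [h3, Function.comp_def] using h2
  simpa using h1

theorem lcmSeries_mul_riemannZeta {s t : ℂ} (hs : 0 < s.re) (ht : 0 < t.re) :
    lcmSeries s t * (riemannZeta (1 + s) * riemannZeta (1 + t)) =
      lcmCorrection s t * riemannZeta (1 + s + t) := by
  have hs1 : 1 < (1 + s).re := by simpa using hs
  have ht1 : 1 < (1 + t).re := by simpa using ht
  have hst1 : 1 < (1 + s + t).re := by simp; linarith
  have h1 := (lcmSeries_hasProd hs ht).mul ((riemannZeta_eulerProduct_hasProd hs1).mul
    (riemannZeta_eulerProduct_hasProd ht1))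
  have h2 := (hasProd_lcmCorrection hs.le ht.le).mul (riemannZeta_eulerProduct_hasProd hst1)
  refine h1.unique ?_
  convert h2 using 2 with p
  have hne : ∀ z : ℂ, 1 < z.re → 1 - (p : ℂ) ^ (-z) ≠ 0 := fun z hz h0 => by
    have h := half_le_norm_one_sub_prime_cpow hz.le p
    rw [h0, norm_zero] at h
    norm_num at h
  have hx := hne _ hs1
  have hy := hne _ ht1
  have hw := hne _ hst1
  unfold lcmLocalFactor
  field_simp
  ring

/-! ### Zeta near its pole and asymptotics of the series -/

theorem norm_riemannZeta_le_tsum {s : ℂ} (hs : 1 < s.re) :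
    ‖riemannZeta s‖ ≤ ∑' n : ℕ, 1 / (n : ℝ) ^ s.re := by
  rw [zeta_eq_tsum_one_div_nat_cpow hs]
  refine tsum_of_norm_bounded (Real.summable_one_div_nat_rpow.2 hs).hasSum fun n => ?_
  rcases Nat.eq_zero_or_pos n with rfl | hn
  · rw [Nat.cast_zero, Complex.zero_cpow (fun h => by simp [h] at hs; linarith)]
    simp [Real.zero_rpow (by linarith : s.re ≠ 0)]
  · rw [norm_div, norm_one, Complex.norm_natCast_cpow_of_pos hn]

open ArithmeticFunction in
theorem norm_riemannZeta_inv_le_tsum {s : ℂ} (hs : 1 < s.re) :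
    ‖(riemannZeta s)⁻¹‖ ≤ ∑' n : ℕ, 1 / (n : ℝ) ^ s.re := by
  have h1 : (riemannZeta s)⁻¹ = LSeries (fun n => ((moebius n : ℤ) : ℂ)) s := by
    have h := LSeries_zeta_mul_Lseries_moebius hs
    rw [LSeries_zeta_eq_riemannZeta hs] at h
    exact inv_eq_of_mul_eq_one_right h
  rw [h1]
  refine tsum_of_norm_bounded (Real.summable_one_div_nat_rpow.2 hs).hasSum fun n => ?_
  rw [LSeries.norm_term_eq]
  split_ifs with hn
  · positivity
  · gcongr
    rw [Complex.norm_intCast]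
    exact_mod_cast abs_moebius_le_one

theorem eventually_tsum_rpow_le :
    ∀ᶠ σ : ℝ in nhdsWithin 0 (Set.Ioi 0), ∑' n : ℕ, 1 / (n : ℝ) ^ (1 + σ) ≤ 2 / σ := by
  have h1 : Filter.Tendsto (fun σ : ℝ => 1 + σ) (nhdsWithin 0 (Set.Ioi 0))
      (nhdsWithin 1 (Set.Ioi 1)) := by
    refine tendsto_nhdsWithin_iff.2 ⟨?_, ?_⟩
    · refine tendsto_nhdsWithin_of_tendsto_nhds ?_
      have : Continuous fun σ : ℝ => 1 + σ := by fun_prop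
      simpa using this.tendsto 0
    · filter_upwards [self_mem_nhdsWithin] with σ hσ
      simpa using hσ
  have h2 := tendsto_sub_mul_tsum_nat_rpow.comp h1
  filter_upwards [h2.eventually (gt_mem_nhds (by norm_num : (1 : ℝ) < 2)),
    self_mem_nhdsWithin] with σ hσ hσ0
  rw [le_div_iff₀ hσ0]
  simp only [Function.comp_apply, add_sub_cancel_left] at hσ
  linarith

theorem tendsto_mul_riemannZeta_one_add :
    Filter.Tendsto (fun s : ℂ => s * riemannZeta (1 + s)) (nhdsWithin 0 {0}ᶜ) (nhds 1) := by
  have h1 : Filter.Tendsto (fun s : ℂ => 1 + s) (nhdsWithin 0 {0}ᶜ) (nhdsWithin 1 {1}ᶜ) := by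
    refine tendsto_nhdsWithin_iff.2 ⟨?_, ?_⟩
    · refine tendsto_nhdsWithin_of_tendsto_nhds ?_
      have : Continuous fun s : ℂ => 1 + s := by fun_prop
      simpa using this.tendsto 0
    · filter_upwards [self_mem_nhdsWithin] with s hs
      simpa using hs
  simpa [Function.comp_def] using riemannZeta_residue_one.comp h1

/-- Near the pole the residue gives `|1/ζ| ≤ 2σ|z|`. When `σ|z| ≥ r`, the trivial bound `2/σ` is at
most `(2/r²) σ|z|²`. The square of `|z|` is the price for using no information on `ζ` high up; the
decay of `ψ` pays for it. -/
theorem exists_norm_riemannZeta_inv_le :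
    ∃ C : ℝ, 0 < C ∧ ∀ᶠ σ : ℝ in nhdsWithin 0 (Set.Ioi 0), ∀ z : ℂ, z.re = 1 →
      ‖(riemannZeta (1 + σ * z))⁻¹‖ ≤ C * σ * ‖z‖ ^ 2 := by
  obtain ⟨r, hr, hball⟩ : ∃ r : ℝ, 0 < r ∧ ∀ s : ℂ, s ≠ 0 → ‖s‖ < r →
      1 / 2 < ‖s * riemannZeta (1 + s)‖ := by
    have h := tendsto_mul_riemannZeta_one_add.norm.eventually
      (lt_mem_nhds (by norm_num : (1 / 2 : ℝ) < ‖(1 : ℂ)‖))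
    rw [eventually_nhdsWithin_iff, Metric.eventually_nhds_iff] at h
    obtain ⟨r, hr, h⟩ := h
    exact ⟨r, hr, fun s hs hsr => h (by simpa using hsr) hs⟩
  refine ⟨2 + 2 / r ^ 2, by positivity, ?_⟩
  filter_upwards [eventually_tsum_rpow_le, self_mem_nhdsWithin] with σ h2 hσ z hz
  have hσ0 : 0 < σ := hσ
  have hz1 : 1 ≤ ‖z‖ := by
    have := Complex.abs_re_le_norm z
    rwa [hz, abs_one] at this
  have hre : (1 + (σ : ℂ) * z).re = 1 + σ := by simp [hz]
  have hn : ‖(σ : ℂ) * z‖ = σ * ‖z‖ := by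
    rw [norm_mul, Complex.norm_real, Real.norm_of_nonneg hσ0.le]
  have hzz : ‖z‖ ≤ ‖z‖ ^ 2 := by nlinarith
  by_cases hs : ‖(σ : ℂ) * z‖ < r
  · have hne : (σ : ℂ) * z ≠ 0 := by
      rw [← norm_pos_iff, hn]; positivity
    have h3 := hball _ hne hs
    rw [norm_mul, hn] at h3
    have hpos : 0 < ‖riemannZeta (1 + σ * z)‖ := by
      by_contra hcon
      have : ‖riemannZeta (1 + σ * z)‖ = 0 := le_antisymm (not_lt.1 hcon) (norm_nonneg _)
      rw [this] at h3
      norm_num at h3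
    rw [norm_inv, inv_le_iff_one_le_mul₀ hpos]
    have h4 : σ * ‖z‖ ≤ σ * ‖z‖ ^ 2 := by gcongr
    have h5 : 0 ≤ 2 / r ^ 2 * (σ * ‖z‖ ^ 2) := by positivity
    calc (1 : ℝ) ≤ 2 * (σ * ‖z‖) * ‖riemannZeta (1 + σ * z)‖ := by linarith
      _ ≤ _ := mul_le_mul_of_nonneg_right (by linarith) hpos.le
  · rw [not_lt, hn] at hs
    have h3 := norm_riemannZeta_inv_le_tsum (s := 1 + σ * z) (by rw [hre]; linarith)
    rw [hre] at h3
    refine (h3.trans h2).trans ?_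
    have h5 : 0 ≤ 2 * (σ * ‖z‖ ^ 2) := by positivity
    have h6 : 2 / σ ≤ 2 / r ^ 2 * (σ * ‖z‖ ^ 2) := by
      rw [div_mul_eq_mul_div, div_le_div_iff₀ hσ0 (by positivity)]
      have : r ^ 2 ≤ (σ * ‖z‖) ^ 2 := by gcongr
      nlinarith
    linarith

theorem lcmSeries_eq {s t : ℂ} (hs : 0 < s.re) (ht : 0 < t.re) :
    lcmSeries s t = lcmCorrection s t * riemannZeta (1 + s + t) *
      (riemannZeta (1 + s))⁻¹ * (riemannZeta (1 + t))⁻¹ := by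
  have h1 : riemannZeta (1 + s) ≠ 0 := riemannZeta_ne_zero_of_one_le_re (by simpa using hs.le)
  have h2 : riemannZeta (1 + t) ≠ 0 := riemannZeta_ne_zero_of_one_le_re (by simpa using ht.le)
  rw [← lcmSeries_mul_riemannZeta hs ht]
  field_simp

theorem exists_norm_lcmSeries_le :
    ∃ C : ℝ, 0 < C ∧ ∀ᶠ σ : ℝ in nhdsWithin 0 (Set.Ioi 0), ∀ z w : ℂ, z.re = 1 → w.re = 1 →
      ‖lcmSeries (σ * z) (σ * w)‖ ≤ C * σ * (‖z‖ ^ 2 * ‖w‖ ^ 2) := by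
  obtain ⟨A, hA, hH⟩ := exists_norm_lcmCorrection_le
  obtain ⟨B, hB, hZ⟩ := exists_norm_riemannZeta_inv_le
  refine ⟨A * 2 * B * B, by positivity, ?_⟩
  filter_upwards [hZ, eventually_tsum_rpow_le, self_mem_nhdsWithin] with σ h1 h2 hσ z w hz hw
  have hσ0 : 0 < σ := hσ
  have hz' : ((σ : ℂ) * z).re = σ := by simp [hz]
  have hw' : ((σ : ℂ) * w).re = σ := by simp [hw]
  have h3 : ‖riemannZeta (1 + σ * z + σ * w)‖ ≤ 2 / σ := by
    have hre : (1 + (σ : ℂ) * z + σ * w).re = 1 + (σ + σ) := by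
      rw [Complex.add_re, Complex.add_re, hz', hw', Complex.one_re, add_assoc]
    refine (norm_riemannZeta_le_tsum (by rw [hre]; linarith)).trans (le_trans ?_ h2)
    rw [hre]
    -- The series at `1 + 2σ` is compared termwise with the one at `1 + σ`.
    refine Summable.tsum_le_tsum (fun n => ?_) (Real.summable_one_div_nat_rpow.2 (by linarith))
      (Real.summable_one_div_nat_rpow.2 (by linarith))
    rcases Nat.eq_zero_or_pos n with rfl | hn
    · simp [Real.zero_rpow (by linarith : 1 + (σ + σ) ≠ 0),
        Real.zero_rpow (by linarith : 1 + σ ≠ 0)]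
    · have hn1 : (1 : ℝ) ≤ n := by exact_mod_cast hn
      gcongr
      linarith
  rw [lcmSeries_eq (by rw [hz']; exact hσ0) (by rw [hw']; exact hσ0), norm_mul, norm_mul, norm_mul]
  calc _ ≤ A * (2 / σ) * (B * σ * ‖z‖ ^ 2) * (B * σ * ‖w‖ ^ 2) := by
        gcongr
        exacts [hH _ _ (by rw [hz']; exact hσ0.le) (by rw [hw']; exact hσ0.le), h1 z hz, h1 w hw]
    _ = _ := by field_simp

theorem tendsto_lcmSeries_div {z w : ℂ} (hz : z.re = 1) (hw : w.re = 1) :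
    Filter.Tendsto (fun σ : ℝ => lcmSeries (σ * z) (σ * w) / σ) (nhdsWithin 0 (Set.Ioi 0))
      (nhds (z * w / (z + w))) := by
  have hlim : ∀ z : ℂ, Filter.Tendsto (fun σ : ℝ => (σ : ℂ) * z) (nhdsWithin 0 (Set.Ioi 0))
      (nhds 0) := fun z => by
    have : Continuous fun σ : ℝ => (σ : ℂ) * z := by fun_prop
    exact tendsto_nhdsWithin_of_tendsto_nhds (by simpa using this.tendsto 0)
  have hres : ∀ z : ℂ, z ≠ 0 → Filter.Tendsto (fun σ : ℝ => (σ * z) * riemannZeta (1 + σ * z))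
      (nhdsWithin 0 (Set.Ioi 0)) (nhds 1) := fun z hz => by
    refine tendsto_mul_riemannZeta_one_add.comp (tendsto_nhdsWithin_iff.2 ⟨hlim z, ?_⟩)
    filter_upwards [self_mem_nhdsWithin] with σ hσ
    have : (σ : ℂ) ≠ 0 := by exact_mod_cast (ne_of_gt hσ : σ ≠ 0)
    simpa [hz] using this
  have hne : ∀ z : ℂ, 0 < z.re → z ≠ 0 := fun z hz h => by simp [h] at hz
  have hz0 := hne z (by rw [hz]; norm_num)
  have hw0 := hne w (by rw [hw]; norm_num)
  have hzw0 := hne (z + w) (by rw [Complex.add_re, hz, hw]; norm_num)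
  have hpos : ∀ z : ℂ, z.re = 1 → ∀ᶠ σ : ℝ in nhdsWithin 0 (Set.Ioi 0), 0 < ((σ : ℂ) * z).re :=
    fun z hz => by
      filter_upwards [self_mem_nhdsWithin] with σ hσ
      simpa [hz] using hσ
  have hH := tendsto_lcmCorrection (hlim z) (hlim w) ((hpos z hz).mono fun _ h => h.le)
    ((hpos w hw).mono fun _ h => h.le)
  have h1 := ((hH.mul (hres _ hzw0)).mul (((hres z hz0).inv₀ one_ne_zero).mul
    ((hres w hw0).inv₀ one_ne_zero))).mul_const (z * w / (z + w))
  simp only [inv_one, mul_one, one_mul] at h1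
  refine h1.congr' ?_
  filter_upwards [hpos z hz, hpos w hw, self_mem_nhdsWithin] with σ h2 h3 hσ
  have hσ0 : (σ : ℂ) ≠ 0 := by exact_mod_cast (ne_of_gt hσ : σ ≠ 0)
  rw [lcmSeries_eq h2 h3, mul_add, ← add_assoc]
  have h4 : riemannZeta (1 + σ * z) ≠ 0 := riemannZeta_ne_zero_of_one_le_re (by simpa using h2.le)
  have h5 : riemannZeta (1 + σ * w) ≠ 0 := riemannZeta_ne_zero_of_one_le_re (by simpa using h3.le)
  field_simp

/-! ### Fourier–Laplace representation of the cutoff -/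

/-- The exponent `1 - 2πiξ`. -/
noncomputable def fourierExponent (ξ : ℝ) : ℂ := 1 - 2 * Real.pi * Complex.I * ξ

theorem fourierExponent_re (ξ : ℝ) : (fourierExponent ξ).re = 1 := by
  simp [fourierExponent]

theorem continuous_fourierExponent : Continuous fourierExponent := by
  unfold fourierExponent
  fun_prop

theorem norm_fourierExponent_sq (ξ : ℝ) :
    ‖fourierExponent ξ‖ ^ 2 = 1 + 4 * Real.pi ^ 2 * ‖ξ‖ ^ 2 := by
  rw [← Complex.normSq_eq_norm_sq, Complex.normSq_apply, Real.norm_eq_abs, sq_abs]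
  simp [fourierExponent]
  ring

theorem one_le_norm_fourierExponent (ξ : ℝ) : 1 ≤ ‖fourierExponent ξ‖ := by
  have := Complex.abs_re_le_norm (fourierExponent ξ)
  rwa [fourierExponent_re, abs_one] at this

open FourierTransform in
-- The tilt by `e^x` moves the exponents to real part `1`, where the Dirichlet series converge
-- absolutely. The formula for `φ'` comes from inverting `g'` as well, as `φ' = e^{-x} (g' - g)`.
theorem exists_laplace_representation {φ : ℝ → ℝ} (hφ : ContDiff ℝ ∞ φ)
    (hc : HasCompactSupport φ) :
    ∃ ψ : ℝ → ℂ, Continuous ψ ∧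
      MeasureTheory.Integrable (fun ξ => ‖ψ ξ‖ * ‖fourierExponent ξ‖ ^ 2) ∧
      (∀ x : ℝ, (φ x : ℂ) = ∫ ξ, ψ ξ * Complex.exp (-(fourierExponent ξ * x))) ∧
      ∀ x : ℝ, ((deriv φ x : ℝ) : ℂ) =
        -∫ ξ, ψ ξ * fourierExponent ξ * Complex.exp (-(fourierExponent ξ * x)) := by
  let g : ℝ → ℂ := fun x => (φ x : ℂ) * Complex.exp x
  have hof : ContDiff ℝ ∞ (fun x : ℝ => (x : ℂ)) := Complex.ofRealCLM.contDiff
  have hg : ContDiff ℝ ∞ g := (hof.comp hφ).mul hof.cexp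
  have hgc : HasCompactSupport g := (hc.comp_left Complex.ofReal_zero).mul_right
  let G : SchwartzMap ℝ ℂ := hgc.toSchwartzMap hg
  let Ψ : SchwartzMap ℝ ℂ := 𝓕 G
  have hΨ : ∀ ξ, Ψ ξ = 𝓕 g ξ := fun ξ => rfl
  have hg0 : Continuous g := hg.continuous
  have hgi : MeasureTheory.Integrable g := G.integrable
  have hg1 : Continuous (deriv g) := hg.continuous_deriv (by norm_cast)
  have hg1i : MeasureTheory.Integrable (deriv g) :=
    hg1.integrable_of_hasCompactSupport hgc.deriv
  have hgd : Differentiable ℝ g := hg.differentiable (by simp)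
  have hFd := Real.fourier_deriv hgi hgd hg1i
  have hint : MeasureTheory.Integrable (fun ξ => ‖Ψ ξ‖ * ‖fourierExponent ξ‖ ^ 2) := by
    have h := (Ψ.integrable.norm (μ := MeasureTheory.volume)).add
      ((Ψ.integrable_pow_mul MeasureTheory.volume 2).const_mul (4 * Real.pi ^ 2))
    refine h.congr (Filter.Eventually.of_forall fun ξ => ?_)
    simp only [Pi.add_apply, norm_fourierExponent_sq]
    ring
  have hint1 : MeasureTheory.Integrable (fun ξ : ℝ => Ψ ξ * (2 * Real.pi * Complex.I * ξ)) := by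
    refine hint.mono' (by have := Ψ.continuous; fun_prop) (Filter.Eventually.of_forall fun ξ => ?_)
    rw [norm_mul]
    gcongr
    have h1 := norm_fourierExponent_sq ξ
    have h2 : ‖2 * (Real.pi : ℂ) * Complex.I * ξ‖ = 2 * Real.pi * ‖ξ‖ := by
      simp [abs_of_pos Real.pi_pos]
    rw [h2, h1]
    nlinarith [sq_nonneg (2 * Real.pi * ‖ξ‖ - 1)]
  have inv0 : ∀ x, g x = ∫ ξ : ℝ, Complex.exp (2 * Real.pi * Complex.I * ξ * x) * Ψ ξ := fun x => by
    have h := congrFun (hg0.fourierInv_fourier_eq hgi (Ψ.integrable)) x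
    rw [← h, Real.fourierInv_eq']
    refine MeasureTheory.integral_congr_ae (Filter.Eventually.of_forall fun ξ => ?_)
    simp only [smul_eq_mul, hΨ]
    congr 2
    simp
    ring
  have inv1 : ∀ x, deriv g x = ∫ ξ : ℝ, Complex.exp (2 * Real.pi * Complex.I * ξ * x) *
      (Ψ ξ * (2 * Real.pi * Complex.I * ξ)) := fun x => by
    have hFd' : 𝓕 (deriv g) = fun ξ : ℝ => Ψ ξ * (2 * Real.pi * Complex.I * ξ) := by
      rw [hFd]
      funext ξ
      rw [smul_eq_mul, hΨ, mul_comm]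
    have h := congrFun (hg1.fourierInv_fourier_eq hg1i (by rw [hFd']; exact hint1)) x
    rw [← h, Real.fourierInv_eq', hFd']
    refine MeasureTheory.integral_congr_ae (Filter.Eventually.of_forall fun ξ => ?_)
    simp only [smul_eq_mul]
    congr 2
    simp
    ring
  have hexp : ∀ ξ x : ℝ, Complex.exp (-(fourierExponent ξ * x)) =
      Complex.exp (-x) * Complex.exp (2 * Real.pi * Complex.I * ξ * x) := fun ξ x => by
    rw [← Complex.exp_add, fourierExponent]
    congr 1
    ring
  have hphi : ∀ x : ℝ, (φ x : ℂ) = ∫ ξ, Ψ ξ * Complex.exp (-(fourierExponent ξ * x)) := fun x => by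
    have h : (φ x : ℂ) = Complex.exp (-x) * g x := by
      simp only [g]
      rw [mul_left_comm, ← Complex.exp_add, neg_add_cancel, Complex.exp_zero, mul_one]
    rw [h, inv0, ← MeasureTheory.integral_const_mul]
    refine MeasureTheory.integral_congr_ae (Filter.Eventually.of_forall fun ξ => ?_)
    simp only [hexp]
    ring
  refine ⟨Ψ, Ψ.continuous, hint, hphi, fun x => ?_⟩
  have hd : HasDerivAt g (((deriv φ x : ℝ) : ℂ) * Complex.exp x + φ x * Complex.exp x) x := by
    have h1 : HasDerivAt (fun x : ℝ => (φ x : ℂ)) ((deriv φ x : ℝ) : ℂ) x :=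
      ((hφ.differentiable (by simp)) x).hasDerivAt.ofReal_comp
    have h2 : HasDerivAt (fun x : ℝ => Complex.exp x) (Complex.exp x) x := by
      simpa using (HasDerivAt.ofReal_comp (hasDerivAt_id x)).cexp
    exact h1.mul h2
  have h1 : ((deriv φ x : ℝ) : ℂ) = Complex.exp (-x) * (deriv g x - g x) := by
    rw [hd.deriv]
    simp only [g]
    rw [add_sub_cancel_right, mul_left_comm, ← Complex.exp_add, neg_add_cancel, Complex.exp_zero,
      mul_one]
  have hbd : ∀ f : ℝ → ℂ, MeasureTheory.Integrable f →
      MeasureTheory.Integrable (fun ξ : ℝ => Complex.exp (2 * Real.pi * Complex.I * ξ * x) * f ξ) :=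
    fun f hf => hf.bdd_mul (c := 1) (by fun_prop) (Filter.Eventually.of_forall fun ξ => by
      rw [Complex.norm_exp]; simp)
  rw [h1, inv0, inv1, ← MeasureTheory.integral_sub (hbd _ hint1) (hbd _ Ψ.integrable),
    ← MeasureTheory.integral_const_mul, ← MeasureTheory.integral_neg]
  refine MeasureTheory.integral_congr_ae (Filter.Eventually.of_forall fun ξ => ?_)
  simp only [hexp]
  rw [fourierExponent]
  ring

open MeasureTheory in
theorem integral_prod_laplace {ψ : ℝ → ℂ} (hψ : Continuous ψ)
    (hint : Integrable (fun ξ => ψ ξ * fourierExponent ξ)) {f : ℝ → ℂ}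
    (hf : ∀ x : ℝ, f x = -∫ ξ, ψ ξ * fourierExponent ξ * Complex.exp (-(fourierExponent ξ * x))) :
    ∫ p : ℝ × ℝ, ψ p.1 * ψ p.2 * (fourierExponent p.1 * fourierExponent p.2 /
      (fourierExponent p.1 + fourierExponent p.2)) = ∫ x in Set.Ioi (0 : ℝ), f x ^ 2 := by
  have hz := continuous_fourierExponent
  have h1 : ∀ x, f x ^ 2 = ∫ p : ℝ × ℝ, ψ p.1 * fourierExponent p.1 *
      (ψ p.2 * fourierExponent p.2) *
      Complex.exp (-((fourierExponent p.1 + fourierExponent p.2) * x)) := fun x => by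
    rw [hf, neg_sq, sq, ← integral_prod_mul]
    refine integral_congr_ae (Filter.Eventually.of_forall fun p => ?_)
    simp only [add_mul, neg_add, Complex.exp_add]
    ring
  simp_rw [h1]
  rw [integral_integral_swap]
  · refine integral_congr_ae (Filter.Eventually.of_forall fun p => ?_)
    have hre : (-(fourierExponent p.1 + fourierExponent p.2)).re < 0 := by
      simp only [Complex.neg_re, Complex.add_re, fourierExponent_re]; norm_num
    have hne : fourierExponent p.1 + fourierExponent p.2 ≠ 0 := fun h => by simp [h] at hre
    have h2 := integral_exp_mul_complex_Ioi hre 0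
    simp only [integral_const_mul, ← neg_mul]
    rw [h2, Complex.ofReal_zero, mul_zero, Complex.exp_zero, neg_div_neg_eq]
    ring
  -- Both exponents have real part `1`, so the kernel has modulus exactly `e^{-2x}`, which justifies
  -- Fubini.
  · have h3 : Integrable (fun x : ℝ => Real.exp (-2 * x)) (volume.restrict (Set.Ioi 0)) :=
      integrableOn_exp_mul_Ioi (by norm_num) 0
    have h4 := h3.mul_prod (hint.mul_prod hint).norm
    refine h4.mono' ?_ (Filter.Eventually.of_forall fun q => le_of_eq ?_)
    · refine Continuous.aestronglyMeasurable ?_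
      simp only [Function.uncurry_def]
      fun_prop
    · simp only [Function.uncurry_def, norm_mul, Complex.norm_exp]
      rw [mul_comm]
      congr 2
      simp only [Complex.neg_re, Complex.mul_re, Complex.add_re, fourierExponent_re,
        Complex.ofReal_re, Complex.ofReal_im, mul_zero, sub_zero]
      ring

/-! ### The quadratic form as an integral, and its limit -/

theorem moebiusTwist_ofReal_mul (σ : ℝ) (z : ℂ) (d : ℕ) :
    moebiusTwist (σ * z) d = (ArithmeticFunction.moebius d : ℂ) *
      Complex.exp (-(z * (σ * Real.log d : ℝ))) := by
  rcases Nat.eq_zero_or_pos d with rfl | hd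
  · simp
  have hd0 : (d : ℂ) ≠ 0 := by exact_mod_cast hd.ne'
  rw [moebiusTwist_apply, Complex.cpow_def_of_ne_zero hd0, ← Complex.natCast_log]
  congr 2
  push_cast
  ring

theorem continuous_moebiusTwist (d : ℕ) : Continuous fun s => moebiusTwist s d := by
  rcases Nat.eq_zero_or_pos d with rfl | hd
  · simpa using continuous_const
  have hd0 : (d : ℂ) ≠ 0 := by exact_mod_cast hd.ne'
  simp only [moebiusTwist_apply]
  exact continuous_const.mul (continuous_neg.const_cpow (Or.inl hd0))

theorem continuous_lcmTerm_fourierExponent (σ : ℝ) (p : ℕ × ℕ) :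
    Continuous fun q : ℝ × ℝ =>
      lcmTerm (σ * fourierExponent q.1) (σ * fourierExponent q.2) p := by
  have hz := continuous_fourierExponent
  unfold lcmTerm
  exact (((continuous_moebiusTwist p.1).comp (by fun_prop)).mul
    ((continuous_moebiusTwist p.2).comp (by fun_prop))).div_const _

theorem norm_lcmTerm_fourierExponent_le {σ : ℝ} (hσ : 0 < σ) (q : ℝ × ℝ) (p : ℕ × ℕ) :
    ‖lcmTerm (σ * fourierExponent q.1) (σ * fourierExponent q.2) p‖ ≤
      (Nat.lcm p.1 p.2 : ℝ) ^ (-(1 + σ)) :=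
  norm_lcmTerm_le hσ (by simp [fourierExponent_re]) (by simp [fourierExponent_re]) p

theorem continuous_lcmSeries_fourierExponent {σ : ℝ} (hσ : 0 < σ) :
    Continuous fun q : ℝ × ℝ => lcmSeries (σ * fourierExponent q.1) (σ * fourierExponent q.2) :=
  continuous_tsum (continuous_lcmTerm_fourierExponent σ) (summable_lcm_rpow hσ)
    fun p q => norm_lcmTerm_fourierExponent_le hσ q p

open MeasureTheory in
theorem hasSum_lcm_integral {φ : ℝ → ℝ} {ψ : ℝ → ℂ} (hψ : Continuous ψ) (hψi : Integrable ψ)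
    (hrep : ∀ x : ℝ, (φ x : ℂ) = ∫ ξ, ψ ξ * Complex.exp (-(fourierExponent ξ * x)))
    {σ : ℝ} (hσ : 0 < σ) :
    HasSum (fun p : ℕ × ℕ =>
      ((ArithmeticFunction.moebius p.1 * φ (σ * Real.log p.1) *
        (ArithmeticFunction.moebius p.2 * φ (σ * Real.log p.2)) / (Nat.lcm p.1 p.2 : ℝ) : ℝ) : ℂ))
      (∫ q : ℝ × ℝ, ψ q.1 * ψ q.2 *
        lcmSeries (σ * fourierExponent q.1) (σ * fourierExponent q.2)) := by
  let F : ℕ × ℕ → ℝ × ℝ → ℂ := fun p q => ψ q.1 * ψ q.2 *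
    lcmTerm (σ * fourierExponent q.1) (σ * fourierExponent q.2) p
  have hψψ : Integrable (fun q : ℝ × ℝ => ‖ψ q.1 * ψ q.2‖) := (hψi.mul_prod hψi).norm
  have hF0 : ∀ p q, ‖F p q‖ ≤ ‖ψ q.1 * ψ q.2‖ * (Nat.lcm p.1 p.2 : ℝ) ^ (-(1 + σ)) :=
    fun p q => by
      rw [norm_mul]
      gcongr
      exact norm_lcmTerm_fourierExponent_le hσ q p
  have hFi : ∀ p, Integrable (F p) := fun p =>
    (hψψ.mul_const _).mono' (((by fun_prop : Continuous fun q : ℝ × ℝ => ψ q.1 * ψ q.2).mul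
      (continuous_lcmTerm_fourierExponent σ p)).aestronglyMeasurable)
      (Filter.Eventually.of_forall (hF0 p))
  have hFs : Summable fun p => ∫ q, ‖F p q‖ := by
    refine ((summable_lcm_rpow hσ).mul_left (∫ q : ℝ × ℝ, ‖ψ q.1 * ψ q.2‖)).of_nonneg_of_le
      (fun p => integral_nonneg fun q => norm_nonneg _) fun p => ?_
    rw [← integral_mul_const]
    exact integral_mono (hFi p).norm (hψψ.mul_const _) (hF0 p)
  have h := hasSum_integral_of_summable_integral_norm hFi hFs
  have h1 : ∀ p : ℕ × ℕ, ∫ q, F p q =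
      ((ArithmeticFunction.moebius p.1 * φ (σ * Real.log p.1) *
        (ArithmeticFunction.moebius p.2 * φ (σ * Real.log p.2)) / (Nat.lcm p.1 p.2 : ℝ) : ℝ) : ℂ) :=
    fun p => by
      push_cast
      rw [hrep, hrep, mul_mul_mul_comm, ← integral_prod_mul, mul_div_right_comm,
        ← integral_const_mul]
      refine integral_congr_ae (Filter.Eventually.of_forall fun q => ?_)
      simp only [F, lcmTerm, moebiusTwist_ofReal_mul]
      ring
  have h2 : ∀ q : ℝ × ℝ, ∑' p, F p q =
      ψ q.1 * ψ q.2 * lcmSeries (σ * fourierExponent q.1) (σ * fourierExponent q.2) := fun q => by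
    simp only [F]
    rw [tsum_mul_left]
    rfl
  simp only [h1, h2] at h
  exact h

open MeasureTheory in
theorem tendsto_integral_lcmSeries_div {ψ : ℝ → ℂ} (hψ : Continuous ψ)
    (hint : Integrable (fun ξ => ‖ψ ξ‖ * ‖fourierExponent ξ‖ ^ 2)) :
    Filter.Tendsto (fun σ : ℝ => ∫ q : ℝ × ℝ, ψ q.1 * ψ q.2 *
        (lcmSeries (σ * fourierExponent q.1) (σ * fourierExponent q.2) / σ))
      (nhdsWithin 0 (Set.Ioi 0))
      (nhds (∫ q : ℝ × ℝ, ψ q.1 * ψ q.2 * (fourierExponent q.1 * fourierExponent q.2 /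
        (fourierExponent q.1 + fourierExponent q.2)))) := by
  obtain ⟨C, hC, hbound⟩ := exists_norm_lcmSeries_le
  refine tendsto_integral_filter_of_dominated_convergence
    (fun q : ℝ × ℝ => C * ((‖ψ q.1‖ * ‖fourierExponent q.1‖ ^ 2) *
      (‖ψ q.2‖ * ‖fourierExponent q.2‖ ^ 2))) ?_ ?_ ((hint.mul_prod hint).const_mul C) ?_
  · filter_upwards [self_mem_nhdsWithin] with σ hσ
    exact (((by fun_prop : Continuous fun q : ℝ × ℝ => ψ q.1 * ψ q.2).mul
      ((continuous_lcmSeries_fourierExponent hσ).div_const _))).aestronglyMeasurable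
  · filter_upwards [hbound, self_mem_nhdsWithin] with σ h hσ
    refine Filter.Eventually.of_forall fun q => ?_
    have hσ0 : 0 < σ := hσ
    have h1 := h _ _ (fourierExponent_re q.1) (fourierExponent_re q.2)
    rw [norm_mul, norm_mul, norm_div, Complex.norm_real, Real.norm_of_nonneg hσ0.le]
    calc _ ≤ ‖ψ q.1‖ * ‖ψ q.2‖ *
          (C * σ * (‖fourierExponent q.1‖ ^ 2 * ‖fourierExponent q.2‖ ^ 2) / σ) := by gcongr
      _ = _ := by field_simp
  · exact Filter.Eventually.of_forall fun q =>
      (tendsto_lcmSeries_div (fourierExponent_re q.1) (fourierExponent_re q.2)).const_mul _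

theorem tendsto_lcm_quadratic_form {φ : ℝ → ℝ} (hφ : ContDiff ℝ ∞ φ)
    (hsupp : Function.support φ ⊆ Set.Icc (-1) 1)
    (hint : ∫ x in (0 : ℝ)..1, |deriv φ x| ^ 2 = 1) :
    Filter.Tendsto (fun R : ℝ => Real.log R *
      ∑ d ∈ Finset.Icc 1 ⌊R⌋₊, ∑ e ∈ Finset.Icc 1 ⌊R⌋₊,
        (ArithmeticFunction.moebius d * φ (Real.log d / Real.log R)) *
        (ArithmeticFunction.moebius e * φ (Real.log e / Real.log R)) / (Nat.lcm d e : ℝ))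
      Filter.atTop (nhds 1) := by
  have hts : tsupport φ ⊆ Set.Icc (-1) 1 := closure_minimal hsupp isClosed_Icc
  have hc : HasCompactSupport φ := HasCompactSupport.of_support_subset_isCompact isCompact_Icc hsupp
  obtain ⟨ψ, hψ, hψi, hrep, hrep'⟩ := exists_laplace_representation hφ hc
  have hψ0 : MeasureTheory.Integrable ψ := by
    refine hψi.mono' hψ.aestronglyMeasurable (Filter.Eventually.of_forall fun ξ => ?_)
    exact le_mul_of_one_le_right (norm_nonneg _) (one_le_pow₀ (one_le_norm_fourierExponent ξ))
  have hψ1 : MeasureTheory.Integrable fun ξ => ψ ξ * fourierExponent ξ := by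
    refine hψi.mono' (hψ.mul continuous_fourierExponent).aestronglyMeasurable
      (Filter.Eventually.of_forall fun ξ => ?_)
    rw [norm_mul]
    gcongr
    exact le_self_pow₀ (one_le_norm_fourierExponent ξ) two_ne_zero
  have hlim := tendsto_integral_lcmSeries_div hψ hψi
  rw [integral_prod_laplace hψ hψ1 hrep'] at hlim
  -- The Laplace integral runs over the half-line, but `φ'` vanishes beyond `1`.
  have hone : ∫ x in Set.Ioi (0 : ℝ), ((deriv φ x : ℝ) : ℂ) ^ 2 = 1 := by
    rw [intervalIntegral.integral_of_le zero_le_one] at hint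
    have h1 : ∫ x in Set.Ioi (0 : ℝ), |deriv φ x| ^ 2 = 1 := by
      rw [← hint]
      refine MeasureTheory.setIntegral_eq_of_subset_of_forall_sdiff_eq_zero measurableSet_Ioi
        Set.Ioc_subset_Ioi_self fun x hx => ?_
      have hx1 : ¬ x ≤ 1 := fun h => hx.2 ⟨hx.1, h⟩
      have : deriv φ x = 0 := by
        by_contra h
        exact hx1 (hts (support_deriv_subset h)).2
      simp [this]
    simp only [sq_abs] at h1
    have h2 : ∀ x, ((deriv φ x : ℝ) : ℂ) ^ 2 = ((deriv φ x ^ 2 : ℝ) : ℂ) :=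
      fun x => by push_cast; rfl
    simp only [h2]
    rw [integral_complex_ofReal, h1, Complex.ofReal_one]
  rw [hone] at hlim
  have hσ : Filter.Tendsto (fun R : ℝ => (Real.log R)⁻¹) Filter.atTop
      (nhdsWithin 0 (Set.Ioi 0)) :=
    tendsto_inv_atTop_nhdsGT_zero.comp Real.tendsto_log_atTop
  have h3 := (Complex.continuous_re.tendsto 1).comp (hlim.comp hσ)
  rw [Complex.one_re] at h3
  refine h3.congr' ?_
  filter_upwards [Filter.eventually_gt_atTop 1] with R hR
  have hL : 0 < Real.log R := Real.log_pos hR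
  have h4 := hasSum_lcm_integral hψ hψ0 hrep (inv_pos.2 hL)
  -- The support of `φ` cuts the infinite double series down to `d, e ≤ R`.
  have hzero : ∀ d : ℕ, d ∉ Finset.Icc 1 ⌊R⌋₊ →
      (ArithmeticFunction.moebius d : ℝ) * φ ((Real.log R)⁻¹ * Real.log d) = 0 := fun d hd => by
    rcases Nat.eq_zero_or_pos d with rfl | hd0
    · simp
    · by_contra hne
      have h5 := (hsupp (right_ne_zero_of_mul hne : φ _ ≠ 0)).2
      rw [← div_eq_inv_mul, div_le_one hL,
        Real.log_le_log_iff (by exact_mod_cast hd0) (by linarith)] at h5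
      exact hd (Finset.mem_Icc.2 ⟨hd0, Nat.le_floor h5⟩)
  have h6 := h4.unique (hasSum_sum_of_ne_finset_zero
    (s := Finset.Icc 1 ⌊R⌋₊ ×ˢ Finset.Icc 1 ⌊R⌋₊) fun p hp => by
      rw [Finset.mem_product, not_and_or] at hp
      rcases hp with hp | hp
      · rw [hzero _ hp]; simp
      · rw [hzero _ hp]; simp)
  rw [← Complex.ofReal_sum, Finset.sum_product] at h6
  have h7 : (∫ q : ℝ × ℝ, ψ q.1 * ψ q.2 *
      (lcmSeries (((Real.log R)⁻¹ : ℝ) * fourierExponent q.1)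
        (((Real.log R)⁻¹ : ℝ) * fourierExponent q.2) / ((Real.log R)⁻¹ : ℝ))) =
      (∫ q : ℝ × ℝ, ψ q.1 * ψ q.2 *
      (lcmSeries (((Real.log R)⁻¹ : ℝ) * fourierExponent q.1)
        (((Real.log R)⁻¹ : ℝ) * fourierExponent q.2))) * (Real.log R : ℝ) := by
    rw [← MeasureTheory.integral_mul_const]
    refine MeasureTheory.integral_congr_ae (Filter.Eventually.of_forall fun q => ?_)
    simp only
    push_cast
    rw [div_inv_eq_mul]
    ring
  simp only [Function.comp_apply]
  rw [h7, h6, ← Complex.ofReal_mul, Complex.ofReal_re, mul_comm]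
  simp only [div_eq_inv_mul (Real.log _) (Real.log R)]

/-! ### Conclusion -/

theorem sum_envelopingSieve_div {R : ℝ} (hR : 1 < R) {φ : ℝ → ℝ}
    (hsupp : Function.support φ ⊆ Set.Icc (-1) 1) (N : ℕ) :
    (∑ n ∈ Finset.Icc 1 N, envelopingSieve R φ (n : ℤ)) / (N : ℝ) = Real.log R *
      ((∑ n ∈ Finset.Icc 1 N, (∑ d ∈ (Finset.Icc 1 ⌊R⌋₊).filter (· ∣ n),
        (ArithmeticFunction.moebius d : ℝ) * φ (Real.log d / Real.log R)) ^ 2) / (N : ℝ)) := by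
  have hL : Real.log R ≠ 0 := (Real.log_pos hR).ne'
  rw [← mul_div_assoc, Finset.mul_sum]
  congr 1
  refine Finset.sum_congr rfl fun n _ => ?_
  rw [envelopingSieve, truncatedVonMangoldt_eq_sum hR hsupp]
  field_simp

theorem proposition2p2 (φ : ℝ → ℝ) (hφ : ContDiff ℝ ∞ φ)
    (hsupp : Function.support φ ⊆ Set.Icc (-1) 1)
    (hint : ∫ x in (0 : ℝ)..1, |deriv φ x| ^ 2 = 1)
    (ε : ℝ) (hε : 0 < ε) :
    ∀ δ : ℝ, 0 < δ → ∃ N₀ : ℕ, ∀ N : ℕ, N₀ ≤ N →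
      ∀ R : ℝ, (N : ℝ) ^ ε ≤ R → R ≤ (N : ℝ) ^ (1 / 2 - ε) →
        |(∑ n ∈ Finset.Icc 1 N, envelopingSieve R φ (n : ℤ)) / (N : ℝ) - 1| ≤ δ := by
  intro δ hδ
  have hc : HasCompactSupport φ := HasCompactSupport.of_support_subset_isCompact isCompact_Icc hsupp
  obtain ⟨C, hC⟩ := hc.exists_bound_of_continuous hφ.continuous
  have hC0 : 0 ≤ C := (norm_nonneg _).trans (hC 0)
  obtain ⟨R₀, hR₀⟩ := Filter.eventually_atTop.1
    ((Metric.tendsto_nhds.1 (tendsto_lcm_quadratic_form hφ hsupp hint)) (δ / 2) (half_pos hδ))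
  have hpow : Filter.Tendsto (fun N : ℕ => (N : ℝ) ^ ε) Filter.atTop Filter.atTop :=
    (tendsto_rpow_atTop hε).comp tendsto_natCast_atTop_atTop
  have hlog : Filter.Tendsto (fun N : ℕ => C ^ 2 * (Real.log N / (N : ℝ) ^ (2 * ε))) Filter.atTop
      (nhds (C ^ 2 * 0)) :=
    (((isLittleO_log_rpow_atTop (by positivity : 0 < 2 * ε)).tendsto_div_nhds_zero).comp
      tendsto_natCast_atTop_atTop).const_mul _
  rw [mul_zero] at hlog
  -- `R₀` brings the main term within `δ/2`, the `2` keeps `log R` positive, and the decay of `C²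
  -- log N / N^(2ε)` leaves `δ/2` for the floor error.
  obtain ⟨N₀, hN₀⟩ := Filter.eventually_atTop.1 ((hpow.eventually_ge_atTop (max R₀ 2)).and
    ((hlog.eventually (gt_mem_nhds (half_pos hδ))).and (Filter.eventually_ge_atTop 1)))
  refine ⟨N₀, fun N hN R hR1 hR2 => ?_⟩
  obtain ⟨h1, h2, h3⟩ := hN₀ N hN
  have hN1 : (1 : ℝ) ≤ N := by exact_mod_cast h3
  have hN0 : (0 : ℝ) < N := by linarith
  have hR : 2 ≤ R := (le_max_right _ _).trans (h1.trans hR1)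
  have hL : 0 < Real.log R := Real.log_pos (by linarith)
  have hmain := hR₀ R ((le_max_left _ _).trans (h1.trans hR1))
  rw [Real.dist_eq] at hmain
  rw [sum_envelopingSieve_div (by linarith) hsupp]
  set c : ℕ → ℝ := fun d => (ArithmeticFunction.moebius d : ℝ) * φ (Real.log d / Real.log R)
  have hcC : ∀ d, |c d| ≤ C := fun d => by
    rw [abs_mul, ← one_mul C]
    gcongr
    · exact_mod_cast ArithmeticFunction.abs_moebius_le_one
    · exact hC _
  have herr := abs_sum_sq_sum_dvd_sub_le c (Finset.Icc 1 ⌊R⌋₊) hcC (N := N) h3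
  have hlogN : Real.log R ≤ Real.log N := by
    refine Real.log_le_log (by linarith) (hR2.trans ?_)
    conv_rhs => rw [← Real.rpow_one (N : ℝ)]
    exact Real.rpow_le_rpow_of_exponent_le hN1 (by linarith)
  have hRsq : R ^ 2 ≤ (N : ℝ) / (N : ℝ) ^ (2 * ε) := by
    calc R ^ 2 ≤ ((N : ℝ) ^ (1 / 2 - ε)) ^ 2 := by gcongr
      _ = (N : ℝ) / (N : ℝ) ^ (2 * ε) := by
        rw [← Real.rpow_natCast, ← Real.rpow_mul hN0.le]
        rw [show (1 / 2 - ε) * ((2 : ℕ) : ℝ) = 1 - 2 * ε by push_cast; ring, Real.rpow_sub hN0,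
          Real.rpow_one]
  have herr2 : Real.log R * ((C * (Finset.Icc 1 ⌊R⌋₊).card) ^ 2 / N) ≤ δ / 2 := by
    rw [Nat.card_Icc, Nat.add_sub_cancel]
    have hfl : (⌊R⌋₊ : ℝ) ≤ R := Nat.floor_le (by linarith)
    calc _ ≤ Real.log N * (C ^ 2 * ((N : ℝ) / (N : ℝ) ^ (2 * ε)) / N) := by
          rw [mul_pow]
          gcongr
          exact (pow_le_pow_left₀ (by positivity) hfl 2).trans hRsq
      _ = C ^ 2 * (Real.log N / (N : ℝ) ^ (2 * ε)) := by field_simp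
      _ ≤ δ / 2 := h2.le
  have hadd := (abs_le.1 hmain.le)
  have hmul := mul_le_mul_of_nonneg_left herr hL.le
  rw [← abs_of_pos hL, ← abs_mul, abs_of_pos hL, mul_sub] at hmul
  have hsub := abs_le.1 (hmul.trans herr2)
  rw [abs_le]
  constructor <;> linarith [hadd.1, hadd.2, hsub.1, hsub.2]
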